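/- **Theorem (Fidelity lower bound between two mixed free-fermionic states).** Let $n$ be a number of qubits (fermionic modes) and let $X_k, Y_k, Z_k$ be the Pauli operators on the $k$-th qubit of $(\mathbb{C}^2)^{\otimes n}$. For $k\in\{1,\dots,n\}$ define the Majorana operators $$\gamma_{2k-1} := \Big(\prod_{j=1}^{k-1} Z_j\Big) X_k, \qquad \gamma_{2k} := \Big(\prod_{j=1}^{k-1} Z_j\Big) Y_k .$$ For a real orthogonal matrix $Q\in \mathrm{O}(2n)$, a free-fermionic unitary associated with $Q$ is a unitary $U_Q$ on $(\mathbb{C}^2)^{\otimes n}$ with $U_Q^\dagger \gamma_\mu U_Q = \sum_{\nu=1}^{2n} Q_{\mu\nu}\gamma_\nu$ for all $\mu\in\{1,\dots,2n\}$. A (possibly mixed) free-fermionic state is an operator of the form $$\rho = U_Q \Big(\bigotimes_{j=1}^n \frac{I+\lambda_j Z_j}{2}\Big) U_Q^\dagger$$ with $Q\in\mathrm{O}(2n)$, $U_Q$ a free-fermionic unitary associated with $Q$, and $\lambda_1,\dots,\lambda_n\in[-1,1]$. The correlation matrix $\Gamma(\rho)$ of a state $\rho$ is the $2n\times 2n$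 matrix with entries $[\Gamma(\rho)]_{j,k} := -\frac{i}{2}\operatorname{Tr}([\gamma_j,\gamma_k]\rho)$. Write $\|A\|_p := \big(\operatorname{Tr}\big((\sqrt{A^\dagger A})^p\big)\big)^{1/p}$ for the Schatten $p$-norm, and $\mathcal{F}(\rho,\sigma) := \big(\operatorname{Tr}\sqrt{\sqrt{\sigma}\,\rho\,\sqrt{\sigma}}\big)^2$ for the fidelity. Then, for any two (possibly mixed) free-fermionic states $\rho,\sigma$ on $n$ qubits, $$\mathcal{F}(\sigma,\rho) \;\ge\; 1-\frac14\,\|\Gamma(\rho)-\Gamma(\sigma)\|_1-\frac18\,\|\Gamma(\rho)-\Gamma(\sigma)\|_2^2 .$$ -/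

import Mathlib

open scoped Matrix MatrixOrder

noncomputable section

namespace FreeFermion

/-- Indices of the computational basis `|x⟩`, `x ∈ {0,1}ⁿ`, of the `n`-qubit space `(ℂ²)^{⊗ n}`. -/
abbrev QubitIdx (n : ℕ) : Type := Fin n → Fin 2

/-- Operators on the `n`-qubit space, as matrices in the computational basis. -/
abbrev Op (n : ℕ) : Type := Matrix (QubitIdx n) (QubitIdx n) ℂ

/-- The set `[2n]` of Majorana indices: the pair `(k, 0)` stands for the index `2k - 1`
and the pair `(k, 1)` for `2k`, where `k` runs through the `n` modes. -/
abbrev MajIdx (n : ℕ) : Type := Fin n × Fin 2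

def pauliX : Matrix (Fin 2) (Fin 2) ℂ := !![0, 1; 1, 0]

def pauliY : Matrix (Fin 2) (Fin 2) ℂ := !![0, -Complex.I; Complex.I, 0]

def pauliZ : Matrix (Fin 2) (Fin 2) ℂ := !![1, 0; 0, -1]

/-- The tensor product `A₁ ⊗ ⋯ ⊗ Aₙ` of single-qubit operators. -/
def tensorOp {n : ℕ} (A : Fin n → Matrix (Fin 2) (Fin 2) ℂ) : Op n :=
  Matrix.of fun x y => ∏ j, A j (x j) (y j)

/-- The Majorana operators in the Jordan-Wigner representation: `(∏_{j<k} Z_j) X_k` at `(k, 0)`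
and `(∏_{j<k} Z_j) Y_k` at `(k, 1)`, the qubits after `k` carrying the identity. -/
def majorana {n : ℕ} (μ : MajIdx n) : Op n :=
  tensorOp fun j =>
    if j < μ.1 then pauliZ
    else if j = μ.1 then (if μ.2 = 0 then pauliX else pauliY)
    else 1

/-- `U` is a free-fermionic unitary associated with the real orthogonal matrix `Q`. -/
def IsFreeFermionicUnitary {n : ℕ} (Q : Matrix (MajIdx n) (MajIdx n) ℝ) (U : Op n) : Prop :=
  Q ∈ Matrix.orthogonalGroup (MajIdx n) ℝ ∧
  U ∈ Matrix.unitaryGroup (QubitIdx n) ℂ ∧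
  ∀ μ, Uᴴ * majorana μ * U = ∑ ν, (Q μ ν : ℂ) • majorana ν

/-- The product state `⨂_j (I + λ_j Z_j) / 2`. -/
def productState {n : ℕ} (l : Fin n → ℝ) : Op n :=
  tensorOp fun j => (1 / 2 : ℂ) • (1 + (l j : ℂ) • pauliZ)

/-- A (possibly mixed) free-fermionic state: `U_Q (⨂_j (I + λ_j Z_j) / 2) U_Q†` for some
orthogonal `Q`, free-fermionic unitary `U_Q` and numbers `λ_j ∈ [-1, 1]`. -/
def IsFreeFermionicState {n : ℕ} (ρ : Op n) : Prop :=
  ∃ (Q : Matrix (MajIdx n) (MajIdx n) ℝ) (U : Op n) (l : Fin n → ℝ),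
    IsFreeFermionicUnitary Q U ∧
    (∀ j, l j ∈ Set.Icc (-1 : ℝ) 1) ∧
    ρ = U * productState l * Uᴴ

/-- The correlation matrix `[Γ(ρ)]_{j,k} = -(i/2) Tr([γ_j, γ_k] ρ)`. -/
def correlationMatrix {n : ℕ} (ρ : Op n) : Matrix (MajIdx n) (MajIdx n) ℂ :=
  Matrix.of fun j k =>
    -(Complex.I / 2) *
      ((majorana j * majorana k - majorana k * majorana j) * ρ).trace

/-- The Schatten `p`-norm `Tr((√(A† A)) ^ p) ^ (1 / p)`, for real `p ≥ 1`. The square root and the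
power are those of the positive semidefinite matrices `A† A` and `√(A† A)`, so the trace is a
nonnegative real number. -/
def schattenNorm {ι : Type*} [Fintype ι] [DecidableEq ι] (p : ℝ) (A : Matrix ι ι ℂ) : ℝ :=
  ((CFC.sqrt (Aᴴ * A)) ^ p).trace.re ^ (1 / p)

/-- The fidelity `F(ρ, σ) = (Tr √(√σ ρ √σ))²` of two positive semidefinite matrices. The trace is a
nonnegative real number. -/
def fidelity {ι : Type*} [Fintype ι] [DecidableEq ι] (ρ σ : Matrix ι ι ℂ) : ℝ :=
  (CFC.sqrt (CFC.sqrt σ * ρ * CFC.sqrt σ)).trace.re ^ 2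

end FreeFermion

end

open scoped Matrix MatrixOrder ComplexOrder

noncomputable section

namespace FreeFermion

/-! ### Trace-norm duality, a Powers-Størmer bound, and fidelity versus overlap of roots -/

section MatrixInequalities

variable {ι : Type*} [Fintype ι] [DecidableEq ι]

/-! Write A = √ρ and B = √σ. The fidelity is the squared trace norm of BA, hence at least (Tr AB)²
(`sq_re_trace_mul_le_fidelity`), so it suffices to bound the overlap of the roots. Read as a vector
in the doubled space, a root behaves like a pure Gaussian state: besides Γ it carries the matrix S
with entries Tr(A γ_μ A γ_ν), and S is the positive root of 1 + Γ²
(`sandwichMatrix_conjRoot_mul_self`).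

Rotating one state to product form makes A the joint vacuum of n mode number operators on the
doubled space. Since B commutes with parity (`IsFreeFermionicUnitary.parity_commute`), its part
outside the vacuum carries at least two excitations, so 1 - (Tr AB)² is at most half the mean
excitation number of B (`one_sub_overlap_le_excitation`). That number is quadratic in the fermions
and so depends only on Γ and S: by `sum_excitation` it is n + ½ Tr Γ₁Γ₂ - ½ Tr S₁S₂, which is a
quarter of ‖Γ₁ - Γ₂‖₂² + ‖S₁ - S₂‖₂² (`four_mul_add_traces`).

Finally ‖S₁ - S₂‖₂² ≤ 2‖Γ₁ - Γ₂‖₁ (`re_trace_sq_sub_le`). The factor 1/2 · 1/4 then yields the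
constants 1/8 and 1/4. -/

theorem sqrt_eq_of_posSemidef {A B : Matrix ι ι ℂ} (hB : B.PosSemidef) (h : B * B = A) :
    CFC.sqrt A = B :=
  CFC.sqrt_unique h (Matrix.nonneg_iff_posSemidef.2 hB)

theorem trace_conj_unitary {U : Matrix ι ι ℂ} (hU : U * Uᴴ = 1) (A : Matrix ι ι ℂ) :
    (Uᴴ * A * U).trace = A.trace := by
  rw [Matrix.trace_mul_comm, ← mul_assoc, hU, one_mul]

omit [DecidableEq ι] in
theorem norm_conjTranspose_mul_apply_le (V P : Matrix ι ι ℂ) (i : ι) :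
    ‖(Vᴴ * P) i i‖ ^ 2 ≤ ((Vᴴ * V) i i).re * ((Pᴴ * P) i i).re := by
  have key : ∀ R : Matrix ι ι ℂ, ((Rᴴ * R) i i).re = ∑ k, ‖R k i‖ ^ 2 := by
    intro R
    simp only [Matrix.mul_apply, Matrix.conjTranspose_apply, Complex.re_sum]
    refine Finset.sum_congr rfl fun k _ => ?_
    have := Complex.conj_mul' (R k i)
    rw [Complex.star_def, this]
    norm_cast
  rw [key, key]
  refine le_trans ?_ (Finset.sum_mul_sq_le_sq_mul_sq Finset.univ (fun k => ‖V k i‖)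
    fun k => ‖P k i‖)
  refine pow_le_pow_left₀ (norm_nonneg _) ?_ 2
  rw [Matrix.mul_apply]
  refine (norm_sum_le _ _).trans (le_of_eq (Finset.sum_congr rfl fun k _ => ?_))
  simp

/-- Every positive semidefinite matrix is unitarily diagonalised, together with its root. -/
theorem exists_diagonalization_sqrt {H : Matrix ι ι ℂ} (hH : H.PosSemidef) :
    ∃ (V : Matrix ι ι ℂ) (e : ι → ℝ), V * Vᴴ = 1 ∧ Vᴴ * V = 1 ∧ (∀ i, 0 ≤ e i) ∧
      Vᴴ * H * V = Matrix.diagonal (fun i => (e i : ℂ)) ∧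
      (CFC.sqrt H).trace.re = ∑ i, √(e i) := by
  set V : Matrix ι ι ℂ := (hH.1.eigenvectorUnitary : Matrix ι ι ℂ) with hV
  have h1 : V * Vᴴ = 1 := Unitary.coe_mul_star_self hH.1.eigenvectorUnitary
  have h2 : Vᴴ * V = 1 := Unitary.coe_star_mul_self hH.1.eigenvectorUnitary
  have hs : H = V * Matrix.diagonal (fun i => (hH.1.eigenvalues i : ℂ)) * Vᴴ := by
    have := hH.1.spectral_theorem
    rwa [Unitary.conjStarAlgAut_apply] at this
  have he := hH.eigenvalues_nonneg
  refine ⟨V, hH.1.eigenvalues, h1, h2, he, ?_, ?_⟩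
  · conv_lhs => rw [hs]
    rw [show ∀ X : Matrix ι ι ℂ, Vᴴ * (V * X * Vᴴ) * V = (Vᴴ * V) * X * (Vᴴ * V) by
      intro X; noncomm_ring, h2]
    simp
  · set R := V * Matrix.diagonal (fun i => ((√(hH.1.eigenvalues i) : ℝ) : ℂ)) * Vᴴ with hR
    have hRp : R.PosSemidef := by
      refine Matrix.PosSemidef.mul_mul_conjTranspose_same ?_ V
      refine Matrix.PosSemidef.diagonal fun i => ?_
      simp
    have hRR : R * R = H := by
      rw [hR, show ∀ X : Matrix ι ι ℂ, V * X * Vᴴ * (V * X * Vᴴ) = V * (X * (Vᴴ * V) * X) * Vᴴ by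
        intro X; noncomm_ring, h2, mul_one, Matrix.diagonal_mul_diagonal]
      refine Eq.trans ?_ hs.symm
      congr 3
      ext i
      rw [← Complex.ofReal_mul, Real.mul_self_sqrt (he i)]
    rw [sqrt_eq_of_posSemidef hRp hRR, hR]
    have := trace_conj_unitary (U := Vᴴ) (by simpa using h2)
      (Matrix.diagonal (fun i => ((√(hH.1.eigenvalues i) : ℝ) : ℂ)))
    rw [Matrix.conjTranspose_conjTranspose] at this
    rw [this, Matrix.trace_diagonal, ← Complex.ofReal_sum, Complex.ofReal_re]

/-- Duality between the operator norm and the trace norm. -/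
theorem abs_trace_mul_le_trace_sqrt (K M : Matrix ι ι ℂ) (hK : (1 - Kᴴ * K).PosSemidef) :
    |(K * M).trace.re| ≤ (CFC.sqrt (Mᴴ * M)).trace.re := by
  obtain ⟨V, e, h1, h2, he, hd, ht⟩ :=
    exists_diagonalization_sqrt (Matrix.posSemidef_conjTranspose_mul_self M)
  rw [ht, ← trace_conj_unitary h1 (K * M)]
  refine (Complex.abs_re_le_norm _).trans ((norm_sum_le _ _).trans ?_)
  -- In an eigenbasis V of M†M, Cauchy-Schwarz against the unit columns of V bounds each diagonal
  -- entry of V†KMV by the norm of a column of KMV; as K is a contraction, this is at most √(e i).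
  -- No polar decomposition is needed.
  refine Finset.sum_le_sum fun i _ => Real.le_sqrt_of_sq_le ?_
  have h := norm_conjTranspose_mul_apply_le V (K * M * V) i
  rw [h2, Matrix.one_apply_eq, Complex.one_re, one_mul, ← mul_assoc Vᴴ] at h
  refine h.trans ?_
  have hp := (hK.conjTranspose_mul_mul_same (M * V)).diag_nonneg (i := i)
  have hexp : (M * V)ᴴ * (1 - Kᴴ * K) * (M * V) =
      Vᴴ * (Mᴴ * M) * V - (K * M * V)ᴴ * (K * M * V) := by
    simp only [Matrix.conjTranspose_mul]
    noncomm_ring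
  rw [hexp, hd] at hp
  have := (Complex.le_def.1 hp).1
  simp at this
  simpa using this

theorem re_trace_mul_nonneg {A B : Matrix ι ι ℂ} (hA : A.PosSemidef) (hB : B.PosSemidef) :
    0 ≤ (A * B).trace.re := by
  have hC : (CFC.sqrt A).PosSemidef := Matrix.nonneg_iff_posSemidef.1 (CFC.sqrt_nonneg A)
  have h := (Complex.le_def.1 (hB.mul_mul_conjTranspose_same (CFC.sqrt A)).trace_nonneg).1
  rwa [hC.1.eq, Matrix.trace_mul_comm, ← mul_assoc,
    CFC.sqrt_mul_sqrt_self A (Matrix.nonneg_iff_posSemidef.2 hA)] at h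

/-- A Hermitian matrix has a Hermitian unitary sign commuting with it. -/
theorem exists_sign_matrix {T : Matrix ι ι ℂ} (hT : T.IsHermitian) :
    ∃ W : Matrix ι ι ℂ, Wᴴ = W ∧ W * W = 1 ∧ W * T = T * W ∧
      (T * W - T).PosSemidef ∧ (T * W + T).PosSemidef := by
  set V : Matrix ι ι ℂ := (hT.eigenvectorUnitary : Matrix ι ι ℂ) with hV
  have h1 : V * Vᴴ = 1 := Unitary.coe_mul_star_self hT.eigenvectorUnitary
  have h2 : Vᴴ * V = 1 := Unitary.coe_star_mul_self hT.eigenvectorUnitary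
  set t := hT.eigenvalues
  have hs : T = V * Matrix.diagonal (fun i => (t i : ℂ)) * Vᴴ := by
    have := hT.spectral_theorem
    rwa [Unitary.conjStarAlgAut_apply] at this
  -- The sign of 0 is taken to be 1, so that W is unitary even for singular T.
  let s : ι → ℝ := fun i => if 0 ≤ t i then 1 else -1
  have hss : ∀ i, s i * s i = 1 := fun i => by by_cases h : 0 ≤ t i <;> simp [s, h]
  have hts : ∀ i, t i * s i = |t i| := fun i => by
    by_cases h : 0 ≤ t i
    · simp [s, h, abs_of_nonneg h]
    · simp [s, h, abs_of_neg (not_le.1 h)]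
  have hmul : ∀ X Y : Matrix ι ι ℂ, V * X * Vᴴ * (V * Y * Vᴴ) = V * (X * Y) * Vᴴ := by
    intro X Y
    rw [show V * X * Vᴴ * (V * Y * Vᴴ) = V * (X * (Vᴴ * V) * Y) * Vᴴ by noncomm_ring, h2, mul_one]
  have hTW : T * (V * Matrix.diagonal (fun i => (s i : ℂ)) * Vᴴ) =
      V * Matrix.diagonal (fun i => ((|t i| : ℝ) : ℂ)) * Vᴴ := by
    conv_lhs => rw [hs]
    rw [hmul, Matrix.diagonal_mul_diagonal]
    simp_rw [← Complex.ofReal_mul, hts]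
  refine ⟨V * Matrix.diagonal (fun i => (s i : ℂ)) * Vᴴ, ?_, ?_, ?_, ?_, ?_⟩
  · simp only [Matrix.conjTranspose_mul, Matrix.conjTranspose_conjTranspose,
      Matrix.diagonal_conjTranspose, mul_assoc]
    congr 3
    ext i
    simp
  · rw [hmul, Matrix.diagonal_mul_diagonal]
    simp_rw [← Complex.ofReal_mul, hss]
    simp [h1]
  · rw [hTW]
    conv_lhs => rw [hs]
    rw [hmul, Matrix.diagonal_mul_diagonal]
    simp_rw [← Complex.ofReal_mul, mul_comm (s _), hts]
  · rw [hTW]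
    conv => enter [1, 2]; rw [hs]
    rw [← Matrix.sub_mul, ← Matrix.mul_sub, Matrix.diagonal_sub]
    refine Matrix.PosSemidef.mul_mul_conjTranspose_same (Matrix.PosSemidef.diagonal fun i => ?_) V
    simp only [Pi.zero_apply, ← Complex.ofReal_sub, Complex.zero_le_real, sub_nonneg]
    exact le_abs_self _
  · rw [hTW]
    conv => enter [1, 2]; rw [hs]
    rw [← Matrix.add_mul, ← Matrix.mul_add, Matrix.diagonal_add]
    refine Matrix.PosSemidef.mul_mul_conjTranspose_same (Matrix.PosSemidef.diagonal fun i => ?_) V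
    simp only [Pi.zero_apply, ← Complex.ofReal_add, Complex.zero_le_real]
    linarith [neg_abs_le (t i)]

/-- A Powers-Størmer type inequality for the roots `S = √(1 + Γ²)`, with `Γ` skew-Hermitian. -/
theorem re_trace_sq_sub_le {S₁ S₂ Γ₁ Γ₂ : Matrix ι ι ℂ} (hS₁ : S₁.PosSemidef)
    (hS₂ : S₂.PosSemidef) (hΓ₁ : Γ₁ᴴ = -Γ₁) (hΓ₂ : Γ₂ᴴ = -Γ₂)
    (h₁ : S₁ * S₁ = 1 + Γ₁ * Γ₁) (h₂ : S₂ * S₂ = 1 + Γ₂ * Γ₂) :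
    ((S₁ - S₂) * (S₁ - S₂)).trace.re ≤
      2 * (CFC.sqrt ((Γ₁ - Γ₂)ᴴ * (Γ₁ - Γ₂))).trace.re := by
  obtain ⟨W, hW, hWW, hWT, hm, hp⟩ := exists_sign_matrix (hS₁.1.sub hS₂.1)
  set T := S₁ - S₂ with hT
  set Δ := Γ₁ - Γ₂ with hΔ
  -- TW = |T| dominates both T and -T, so Tr T² = Tr TS₁ - Tr TS₂ ≤ Tr |T|(S₁ + S₂).
  have e₁ := re_trace_mul_nonneg hm hS₁
  have e₂ := re_trace_mul_nonneg hp hS₂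
  -- Both WΓ₁ and Γ₂W are contractions, because 1 - Γ†Γ = 1 + Γ² = S² is positive.
  have k₁ := abs_trace_mul_le_trace_sqrt (W * Γ₁) Δ (by
    have : 1 - (W * Γ₁)ᴴ * (W * Γ₁) = S₁ᴴ * S₁ := by
      rw [Matrix.conjTranspose_mul, hW, hΓ₁, hS₁.1.eq, h₁,
        show -Γ₁ * W * (W * Γ₁) = -(Γ₁ * (W * W) * Γ₁) by noncomm_ring, hWW]
      noncomm_ring
    rw [this]
    exact Matrix.posSemidef_conjTranspose_mul_self _)
  have k₂ := abs_trace_mul_le_trace_sqrt (Γ₂ * W) Δ (by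
    have : 1 - (Γ₂ * W)ᴴ * (Γ₂ * W) = (S₂ * W)ᴴ * (S₂ * W) := by
      rw [Matrix.conjTranspose_mul, Matrix.conjTranspose_mul, hW, hΓ₂, hS₂.1.eq,
        show W * S₂ * (S₂ * W) = W * (S₂ * S₂) * W by noncomm_ring, h₂, mul_add, add_mul,
        mul_one, hWW]
      noncomm_ring
    rw [this]
    exact Matrix.posSemidef_conjTranspose_mul_self _)
  -- Both sides are the same difference S₁² - S₂² = Γ₁² - Γ₂², split so that under Tr W(·) the left
  -- becomes Tr |T|(S₁ + S₂) and the right pairs Δ with the two contractions.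
  have hsq : S₁ * T + T * S₂ = Γ₁ * Δ + Δ * Γ₂ := by
    have : S₁ * T + T * S₂ = S₁ * S₁ - S₂ * S₂ := by rw [hT]; noncomm_ring
    rw [this, h₁, h₂, hΔ]
    noncomm_ring
  have htr : (W * Γ₁ * Δ).trace + (Γ₂ * W * Δ).trace =
      (T * W * S₁).trace + (T * W * S₂).trace := by
    have a₁ : (Γ₂ * W * Δ).trace = (W * (Δ * Γ₂)).trace := by
      rw [mul_assoc, Matrix.trace_mul_comm, mul_assoc]
    have a₂ : (T * W * S₁).trace = (W * (S₁ * T)).trace := by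
      rw [mul_assoc, Matrix.trace_mul_comm, mul_assoc]
    rw [a₁, a₂, ← hWT, mul_assoc W, mul_assoc W, ← Matrix.trace_add, ← Matrix.trace_add, ← mul_add,
      ← mul_add, hsq]
  have htr' := congrArg Complex.re htr
  have hTT : T * T = T * S₁ - T * S₂ := by rw [← mul_sub]
  rw [sub_mul] at e₁
  rw [add_mul] at e₂
  rw [hTT]
  simp only [Matrix.trace_sub, Matrix.trace_add, Complex.sub_re, Complex.add_re] at *
  have := le_abs_self (W * Γ₁ * Δ).trace.re
  have := le_abs_self (Γ₂ * W * Δ).trace.re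
  linarith

theorem schattenNorm_one (A : Matrix ι ι ℂ) :
    schattenNorm 1 A = (CFC.sqrt (Aᴴ * A)).trace.re := by
  rw [schattenNorm, CFC.rpow_one _ (CFC.sqrt_nonneg _)]
  simp

theorem schattenNorm_two_sq (A : Matrix ι ι ℂ) :
    schattenNorm 2 A ^ 2 = (Aᴴ * A).trace.re := by
  have hA := Matrix.posSemidef_conjTranspose_mul_self A
  have h : (CFC.sqrt (Aᴴ * A)) ^ (2 : ℝ) = Aᴴ * A := by
    have := CFC.rpow_natCast (CFC.sqrt (Aᴴ * A)) 2 (CFC.sqrt_nonneg _)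
    rw [Nat.cast_ofNat] at this
    rw [this, pow_two, CFC.sqrt_mul_sqrt_self _ (Matrix.nonneg_iff_posSemidef.2 hA)]
  rw [schattenNorm, h, ← Real.sqrt_eq_rpow]
  exact Real.sq_sqrt (Complex.le_def.1 hA.trace_nonneg).1

/-- The fidelity is at least the squared overlap of the square roots. -/
theorem sq_re_trace_mul_le_fidelity {ρ σ A B : Matrix ι ι ℂ} (hA : A.PosSemidef)
    (hB : B.PosSemidef) (hρ : A * A = ρ) (hσ : B * B = σ) :
    (A * B).trace.re ^ 2 ≤ fidelity σ ρ := by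
  rw [fidelity, sqrt_eq_of_posSemidef hA hρ]
  have h : A * σ * A = (B * A)ᴴ * (B * A) := by
    rw [Matrix.conjTranspose_mul, hA.1.eq, hB.1.eq, ← hσ]
    noncomm_ring
  rw [h]
  have key := abs_trace_mul_le_trace_sqrt 1 (B * A) (by simpa using Matrix.PosSemidef.zero)
  rw [one_mul, Matrix.trace_mul_comm] at key
  rw [← sq_abs]
  exact pow_le_pow_left₀ (abs_nonneg _) key 2

end MatrixInequalities

/-! ### Tensor products, Pauli relations and parity -/

section TensorProducts

variable {n : ℕ}

theorem tensorOp_mul (A B : Fin n → Matrix (Fin 2) (Fin 2) ℂ) :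
    tensorOp A * tensorOp B = tensorOp fun j => A j * B j := by
  ext x y
  simp only [tensorOp, Matrix.mul_apply, Matrix.of_apply, ← Finset.prod_mul_distrib]
  rw [Finset.prod_univ_sum, Fintype.piFinset_univ]

theorem trace_tensorOp (A : Fin n → Matrix (Fin 2) (Fin 2) ℂ) :
    (tensorOp A).trace = ∏ j, (A j).trace := by
  simp only [tensorOp, Matrix.trace, Matrix.diag_apply, Matrix.of_apply]
  rw [Finset.prod_univ_sum, Fintype.piFinset_univ]

theorem tensorOp_smul (c : Fin n → ℂ) (A : Fin n → Matrix (Fin 2) (Fin 2) ℂ) :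
    tensorOp (fun j => c j • A j) = (∏ j, c j) • tensorOp A := by
  ext x y
  simp [tensorOp, Finset.prod_mul_distrib]

/-- Lets Jordan-Wigner signs and phases be read off from the one qubit where they arise. -/
theorem tensorOp_smul_at (i : Fin n) (c : ℂ) {A B : Fin n → Matrix (Fin 2) (Fin 2) ℂ}
    (h : ∀ j, A j = (if j = i then c else 1) • B j) : tensorOp A = c • tensorOp B := by
  rw [funext h, tensorOp_smul]
  simp

/-- The sign of `Z` on a basis vector of one qubit. -/
def zSign (a : Fin 2) : ℝ := if a = 0 then 1 else -1

theorem zSign_mul_self (a : Fin 2) : zSign a * zSign a = 1 := by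
  fin_cases a <;> simp [zSign]

theorem pauliZ_eq : pauliZ = Matrix.diagonal fun a => (zSign a : ℂ) := by
  ext a b
  fin_cases a <;> fin_cases b <;> simp [pauliZ, zSign]

theorem tensorOp_diagonal (d : Fin n → Fin 2 → ℂ) :
    tensorOp (fun j => Matrix.diagonal (d j)) = Matrix.diagonal fun x => ∏ j, d j (x j) := by
  ext x y
  by_cases h : x = y
  · subst h
    simp [tensorOp]
  · obtain ⟨k, hk⟩ := Function.ne_iff.1 h
    rw [Matrix.diagonal_apply_ne _ h]
    exact Finset.prod_eq_zero (Finset.mem_univ k) (Matrix.diagonal_apply_ne _ hk)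

/-- The operator `Z` on the qubit `i`. -/
def zOp (i : Fin n) : Op n := tensorOp fun j => if j = i then pauliZ else 1

/-- The parity operator `Z ⊗ ⋯ ⊗ Z`. -/
def parityOp (n : ℕ) : Op n := tensorOp fun _ => pauliZ

theorem zOp_eq_diagonal (i : Fin n) : zOp i = Matrix.diagonal fun x => (zSign (x i) : ℂ) := by
  have : (fun j => if j = i then pauliZ else 1) =
      fun j => Matrix.diagonal fun a => if j = i then (zSign a : ℂ) else 1 := by
    funext j
    split_ifs
    · exact pauliZ_eq
    · simp
  rw [zOp, this, tensorOp_diagonal]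
  simp

theorem parityOp_eq_diagonal :
    parityOp n = Matrix.diagonal fun x => ((∏ j, zSign (x j) : ℝ) : ℂ) := by
  rw [parityOp, pauliZ_eq, tensorOp_diagonal]
  simp

theorem pauli_mul_self :
    pauliX * pauliX = 1 ∧ pauliY * pauliY = 1 ∧ pauliZ * pauliZ = 1 := by
  refine ⟨?_, ?_, ?_⟩ <;> ext a b <;> fin_cases a <;> fin_cases b <;>
    simp [pauliX, pauliY, pauliZ]

theorem pauliX_mul_pauliY : pauliX * pauliY = Complex.I • pauliZ := by
  ext a b
  fin_cases a <;> fin_cases b <;> simp [pauliX, pauliY, pauliZ]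

theorem pauliY_mul_pauliX : pauliY * pauliX = (-Complex.I) • pauliZ := by
  ext a b
  fin_cases a <;> fin_cases b <;> simp [pauliX, pauliY, pauliZ]

theorem pauliZ_mul_pauliX : pauliZ * pauliX = (-1 : ℂ) • (pauliX * pauliZ) := by
  ext a b
  fin_cases a <;> fin_cases b <;> simp [pauliX, pauliZ]

theorem pauliZ_mul_pauliY : pauliZ * pauliY = (-1 : ℂ) • (pauliY * pauliZ) := by
  ext a b
  fin_cases a <;> fin_cases b <;> simp [pauliY, pauliZ]

/-- Z commutes with every factor of the Jordan-Wigner string except the X or Y at the mode of μ,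
which contributes the only sign. -/
theorem parityOp_mul_majorana (μ : MajIdx n) :
    parityOp n * majorana μ = -(majorana μ * parityOp n) := by
  rw [parityOp, majorana, tensorOp_mul, tensorOp_mul, ← neg_one_smul ℂ]
  refine tensorOp_smul_at μ.1 (-1) fun j => ?_
  rcases lt_trichotomy j μ.1 with h | h | h
  · simp [h, h.ne]
  · subst h
    simp only [lt_irrefl, if_false, if_true]
    split_ifs
    · exact pauliZ_mul_pauliX
    · exact pauliZ_mul_pauliY
  · simp [h.not_gt, h.ne']

theorem majorana_zero_mul_one (i : Fin n) :
    majorana (i, 0) * majorana (i, 1) = Complex.I • zOp i := by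
  rw [majorana, majorana, tensorOp_mul, zOp]
  refine tensorOp_smul_at i _ fun j => ?_
  rcases lt_trichotomy j i with h | h | h
  · simp [h, h.ne, pauli_mul_self]
  · subst h
    simp [pauliX_mul_pauliY]
  · simp [h.not_gt, h.ne']

theorem majorana_one_mul_zero (i : Fin n) :
    majorana (i, 1) * majorana (i, 0) = (-Complex.I) • zOp i := by
  rw [majorana, majorana, tensorOp_mul, zOp]
  refine tensorOp_smul_at i _ fun j => ?_
  rcases lt_trichotomy j i with h | h | h
  · simp [h, h.ne, pauli_mul_self]
  · subst h
    simp [pauliY_mul_pauliX]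
  · simp [h.not_gt, h.ne']

end TensorProducts

/-! ### Product states and their square roots -/

section ProductStates

variable {n : ℕ}

/-- The amplitudes `√((1 ± t) / 2)` of the square root of `(1 + t Z) / 2`. -/
def amp (t : ℝ) (a : Fin 2) : ℝ := √((1 + t * zSign a) / 2)

theorem amp_nonneg (t : ℝ) (a : Fin 2) : 0 ≤ amp t a := Real.sqrt_nonneg _

theorem amp_sq {t : ℝ} (ht : t ∈ Set.Icc (-1 : ℝ) 1) (a : Fin 2) :
    amp t a ^ 2 = (1 + t * zSign a) / 2 := by
  refine Real.sq_sqrt ?_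
  obtain ⟨h1, h2⟩ := ht
  fin_cases a <;> simp [zSign] <;> linarith

theorem amp_sq_add {t : ℝ} (ht : t ∈ Set.Icc (-1 : ℝ) 1) : amp t 0 ^ 2 + amp t 1 ^ 2 = 1 := by
  rw [amp_sq ht, amp_sq ht]
  simp [zSign]
  ring

/-- The number `√(1 - t²)`. -/
def spread (t : ℝ) : ℝ := 2 * (amp t 0 * amp t 1)

theorem spread_nonneg (t : ℝ) : 0 ≤ spread t :=
  mul_nonneg zero_le_two (mul_nonneg (amp_nonneg _ _) (amp_nonneg _ _))

theorem spread_mul_self {t : ℝ} (ht : t ∈ Set.Icc (-1 : ℝ) 1) :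
    spread t * spread t = 1 - t * t := by
  have h0 := amp_sq ht 0
  have h1 := amp_sq ht 1
  have : spread t * spread t = 4 * (amp t 0 ^ 2 * amp t 1 ^ 2) := by
    rw [spread]
    ring
  rw [this, h0, h1]
  simp [zSign]
  ring

/-- The square root of a product state. -/
def rootState (l : Fin n → ℝ) : Op n :=
  tensorOp fun j => Matrix.diagonal fun a => (amp (l j) a : ℂ)

theorem rootState_eq_diagonal (l : Fin n → ℝ) :
    rootState l = Matrix.diagonal fun x => ((∏ j, amp (l j) (x j) : ℝ) : ℂ) := by
  rw [rootState, tensorOp_diagonal]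
  simp

theorem rootState_posSemidef (l : Fin n → ℝ) : (rootState l).PosSemidef := by
  rw [rootState_eq_diagonal]
  refine Matrix.PosSemidef.diagonal fun x => ?_
  rw [Pi.zero_apply, Complex.zero_le_real]
  exact Finset.prod_nonneg fun j _ => amp_nonneg _ _

theorem diagonal_amp_mul_self {t : ℝ} (ht : t ∈ Set.Icc (-1 : ℝ) 1) :
    (Matrix.diagonal fun a => (amp t a : ℂ)) * (Matrix.diagonal fun a => (amp t a : ℂ)) =
      (1 / 2 : ℂ) • (1 + (t : ℂ) • pauliZ) := by
  rw [Matrix.diagonal_mul_diagonal, pauliZ_eq]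
  have h : ∀ a, (amp t a : ℂ) * (amp t a : ℂ) = (1 + t * zSign a) / 2 := fun a => by
    have := amp_sq ht a
    rw [← Complex.ofReal_mul, ← pow_two, this]
    push_cast
    ring
  simp_rw [h]
  ext a b
  by_cases hab : a = b
  · subst hab
    simp
    ring
  · simp [hab]

theorem rootState_mul_self {l : Fin n → ℝ} (hl : ∀ j, l j ∈ Set.Icc (-1 : ℝ) 1) :
    rootState l * rootState l = productState l := by
  rw [rootState, tensorOp_mul, productState]
  congr 1
  funext j
  exact diagonal_amp_mul_self (hl j)

theorem trace_productState (l : Fin n → ℝ) : (productState l).trace = 1 := by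
  rw [productState, trace_tensorOp]
  refine Finset.prod_eq_one fun j _ => ?_
  simp [pauliZ, Matrix.trace_fin_two]

end ProductStates

/-! ### The matrices Γ and S: values on product states and behaviour under rotations -/

section Covariance

variable {n : ℕ}

/-- The matrix `Tr(B γ_μ B γ_ν)`. -/
def sandwichMatrix (B : Op n) : Matrix (MajIdx n) (MajIdx n) ℂ :=
  Matrix.of fun μ ν => (B * majorana μ * B * majorana ν).trace

/-- The correlation matrix of a product state: diagonal blocks `[[0, l], [-l, 0]]`. -/
def productCorrelation (l : Fin n → ℝ) : Matrix (MajIdx n) (MajIdx n) ℂ :=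
  Matrix.of fun μ ν => if μ.1 = ν.1 then (l μ.1 : ℂ) * !![0, 1; -1, 0] μ.2 ν.2 else 0

theorem trace_pauli_mul_diagonal (P : Matrix (Fin 2) (Fin 2) ℂ) (hP : ∀ a, P a a = 0)
    (d e : Fin 2 → ℂ) : (Matrix.diagonal d * P * Matrix.diagonal e).trace = 0 := by
  simp [Matrix.trace_fin_two, Matrix.mul_apply, Matrix.diagonal_apply, hP]

theorem pauli_diag_eq_zero (s a : Fin 2) : (if s = 0 then pauliX else pauliY) a a = 0 := by
  fin_cases s <;> fin_cases a <;> simp [pauliX, pauliY]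

/-- Two Majorana operators of different modes have no diagonal correlations. -/
theorem trace_diagonal_majorana_eq_zero {μ ν : MajIdx n} (h : μ.1 ≠ ν.1)
    (d e : Fin n → Fin 2 → ℂ) :
    (tensorOp (fun j => Matrix.diagonal (d j)) * majorana μ *
      tensorOp (fun j => Matrix.diagonal (e j)) * majorana ν).trace = 0 := by
  rw [majorana, majorana, tensorOp_mul, tensorOp_mul, tensorOp_mul, trace_tensorOp]
  refine Finset.prod_eq_zero (Finset.mem_univ μ.1) ?_
  simp only [lt_irrefl, if_false, if_true, if_neg h]
  by_cases h' : μ.1 < ν.1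
  · rw [if_pos h', pauliZ_eq, mul_assoc, Matrix.diagonal_mul_diagonal]
    exact trace_pauli_mul_diagonal _ (pauli_diag_eq_zero μ.2) _ _
  · rw [if_neg h', mul_one]
    exact trace_pauli_mul_diagonal _ (pauli_diag_eq_zero μ.2) _ _

/-- Within one mode, the strings cancel in pairs and leave factors of trace 1, while the site itself
gives Tr(DXDX) = Tr(DYDY) = 2 · amp · amp; the mixed XY terms cancel. -/
theorem sandwichMatrix_rootState {l : Fin n → ℝ} (hl : ∀ j, l j ∈ Set.Icc (-1 : ℝ) 1) :
    sandwichMatrix (rootState l) = Matrix.diagonal fun μ => (spread (l μ.1) : ℂ) := by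
  ext ⟨i, s⟩ ⟨j, t⟩
  rw [sandwichMatrix, Matrix.of_apply]
  by_cases hij : i = j
  swap
  · rw [Matrix.diagonal_apply_ne _ (by simp [hij])]
    exact trace_diagonal_majorana_eq_zero (μ := (i, s)) (ν := (j, t)) hij _ _
  subst hij
  have hsite : ∀ k, k ≠ i → ((Matrix.diagonal fun a => (amp (l k) a : ℂ)) *
      (if k < i then pauliZ else 1) * (Matrix.diagonal fun a => (amp (l k) a : ℂ)) *
      (if k < i then pauliZ else 1)).trace = 1 := by
    intro k _
    have h : ((amp (l k) 0 : ℂ)) ^ 2 + (amp (l k) 1 : ℂ) ^ 2 = 1 := by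
      exact_mod_cast amp_sq_add (hl k)
    split_ifs
    · simp [pauliZ, Matrix.trace_fin_two, Matrix.mul_apply, Matrix.diagonal_apply]
      linear_combination h
    · simp
      linear_combination h
  rw [rootState, majorana, majorana, tensorOp_mul, tensorOp_mul, tensorOp_mul, trace_tensorOp,
    Finset.prod_eq_single i]
  · simp only [lt_irrefl, if_false, if_true]
    fin_cases s <;> fin_cases t <;>
      simp [pauliX, pauliY, Matrix.trace_fin_two, Matrix.mul_apply, Matrix.diagonal_apply, spread]
    · ring
    · ring
    · ring
    · linear_combination (-(2 : ℂ) * amp (l i) 0 * amp (l i) 1) * Complex.I_mul_I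
  · intro k _ hk
    simpa [hk] using hsite k hk
  · simp

theorem correlationMatrix_zero_one (ρ : Op n) (i : Fin n) :
    correlationMatrix ρ (i, 0) (i, 1) = (zOp i * ρ).trace := by
  rw [correlationMatrix, Matrix.of_apply, majorana_zero_mul_one, majorana_one_mul_zero,
    ← sub_smul, Matrix.smul_mul, Matrix.trace_smul, smul_eq_mul]
  linear_combination (-(zOp i * ρ).trace) * Complex.I_mul_I

theorem correlationMatrix_one_zero (ρ : Op n) (i : Fin n) :
    correlationMatrix ρ (i, 1) (i, 0) = -(zOp i * ρ).trace := by
  rw [correlationMatrix, Matrix.of_apply, majorana_zero_mul_one, majorana_one_mul_zero,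
    ← sub_smul, Matrix.smul_mul, Matrix.trace_smul, smul_eq_mul]
  linear_combination (zOp i * ρ).trace * Complex.I_mul_I

theorem correlationMatrix_productState {l : Fin n → ℝ} (hl : ∀ j, l j ∈ Set.Icc (-1 : ℝ) 1) :
    correlationMatrix (productState l) = productCorrelation l := by
  have hz : ∀ i, (zOp i * productState l).trace = l i := by
    intro i
    rw [zOp, productState, tensorOp_mul, trace_tensorOp, Finset.prod_eq_single i]
    · simp only [if_true, Matrix.mul_smul, mul_add, mul_one, pauli_mul_self]
      simp [pauliZ, Matrix.trace_fin_two]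
      ring
    · intro k _ hk
      simp [hk, pauliZ, Matrix.trace_fin_two]
    · simp
  ext ⟨i, s⟩ ⟨j, t⟩
  rw [correlationMatrix, Matrix.of_apply, productCorrelation, Matrix.of_apply]
  by_cases hij : i = j
  · subst hij
    fin_cases s <;> fin_cases t
    · simp
    · simpa [correlationMatrix] using (correlationMatrix_zero_one (productState l) i).trans (hz i)
    · simpa [correlationMatrix] using
        (correlationMatrix_one_zero (productState l) i).trans (congrArg Neg.neg (hz i))
    · simp
  · have key : ∀ μ ν : MajIdx n, μ.1 ≠ ν.1 →
        (majorana μ * majorana ν * productState l).trace = 0 := by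
      intro μ ν h
      -- Moved cyclically to the front, the state is the first diagonal factor of
      -- `trace_diagonal_majorana_eq_zero`; the second is taken to be the identity.
      have h1 : tensorOp (fun _ : Fin n => Matrix.diagonal fun _ => 1) = (1 : Op n) := by
        rw [tensorOp_diagonal]
        simp
      have := trace_diagonal_majorana_eq_zero h
        (fun j a => (amp (l j) a : ℂ) * (amp (l j) a : ℂ)) fun _ _ => 1
      rw [h1, mul_one] at this
      rw [Matrix.trace_mul_comm, ← rootState_mul_self hl, rootState, tensorOp_mul, ← mul_assoc]
      simp_rw [Matrix.diagonal_mul_diagonal]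
      exact this
    rw [sub_mul, Matrix.trace_sub, key _ _ hij, key _ _ (Ne.symm hij)]
    simp [hij]

variable {Q : Matrix (MajIdx n) (MajIdx n) ℝ} {U : Op n}

/-- A real matrix as a complex one. -/
abbrev toComplex (Q : Matrix (MajIdx n) (MajIdx n) ℝ) : Matrix (MajIdx n) (MajIdx n) ℂ :=
  Q.map Complex.ofReal

theorem IsFreeFermionicUnitary.mul_conjTranspose (h : IsFreeFermionicUnitary Q U) :
    U * Uᴴ = 1 := Matrix.mem_unitaryGroup_iff.1 h.2.1

theorem IsFreeFermionicUnitary.conjTranspose_mul (h : IsFreeFermionicUnitary Q U) :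
    Uᴴ * U = 1 := Matrix.mem_unitaryGroup_iff'.1 h.2.1

theorem IsFreeFermionicUnitary.toComplex_mul_transpose (h : IsFreeFermionicUnitary Q U) :
    toComplex Q * (toComplex Q)ᵀ = 1 := by
  have := (Matrix.mem_orthogonalGroup_iff _ _).1 h.1
  rw [toComplex, ← Matrix.transpose_map]
  have h2 := congrArg (fun M => M.map (Complex.ofRealHom)) this
  rw [Matrix.map_mul, Matrix.map_one _ (map_zero _) (map_one _)] at h2
  exact h2

theorem IsFreeFermionicUnitary.transpose_mul_toComplex (h : IsFreeFermionicUnitary Q U) :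
    (toComplex Q)ᵀ * toComplex Q = 1 :=
  mul_eq_one_comm.1 h.toComplex_mul_transpose

theorem correlationMatrix_conj (h : IsFreeFermionicUnitary Q U) (ρ : Op n) :
    correlationMatrix (U * ρ * Uᴴ) =
      toComplex Q * correlationMatrix ρ * (toComplex Q)ᵀ := by
  have key : ∀ μ ν, (majorana μ * majorana ν * (U * ρ * Uᴴ)).trace =
      ∑ κ, ∑ ι, (Q μ κ : ℂ) * Q ν ι * (majorana κ * majorana ι * ρ).trace := by
    intro μ ν
    have : (majorana μ * majorana ν * (U * ρ * Uᴴ)).trace =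
        ((Uᴴ * majorana μ * U) * (Uᴴ * majorana ν * U) * ρ).trace := by
      rw [show majorana μ * majorana ν * (U * ρ * Uᴴ) =
        (majorana μ * majorana ν * U * ρ) * Uᴴ by noncomm_ring, Matrix.trace_mul_comm,
        show (Uᴴ * majorana μ * U) * (Uᴴ * majorana ν * U) * ρ =
          Uᴴ * majorana μ * (U * Uᴴ) * majorana ν * U * ρ by noncomm_ring, h.mul_conjTranspose]
      noncomm_ring
    rw [this, h.2.2, h.2.2]
    simp only [Finset.sum_mul, Finset.mul_sum, Matrix.smul_mul, Matrix.mul_smul, Matrix.trace_sum,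
      Matrix.trace_smul, smul_eq_mul]
    rw [Finset.sum_comm]
    refine Finset.sum_congr rfl fun κ _ => Finset.sum_congr rfl fun ι _ => ?_
    ring
  ext μ ν
  rw [correlationMatrix, Matrix.of_apply, sub_mul, Matrix.trace_sub, key, key]
  simp only [Matrix.mul_apply, Matrix.transpose_apply, Matrix.map_apply, Finset.sum_mul,
    correlationMatrix, Matrix.of_apply, sub_mul, Matrix.trace_sub]
  conv_lhs => enter [2, 2]; rw [Finset.sum_comm]
  rw [← Finset.sum_sub_distrib, Finset.mul_sum, Finset.sum_comm]
  refine Finset.sum_congr rfl fun κ _ => ?_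
  rw [← Finset.sum_sub_distrib, Finset.mul_sum]
  refine Finset.sum_congr rfl fun ι _ => ?_
  ring

/-- By cyclicity, U can be moved onto the Majorana operators. S thus obeys the same law as Γ, so
relations between the two need only be checked on product states. -/
theorem sandwichMatrix_conj (h : IsFreeFermionicUnitary Q U) (B : Op n) :
    sandwichMatrix (U * B * Uᴴ) = toComplex Q * sandwichMatrix B * (toComplex Q)ᵀ := by
  ext μ ν
  have : (U * B * Uᴴ * majorana μ * (U * B * Uᴴ) * majorana ν).trace =
      (B * (Uᴴ * majorana μ * U) * B * (Uᴴ * majorana ν * U)).trace := by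
    rw [show U * B * Uᴴ * majorana μ * (U * B * Uᴴ) * majorana ν =
      U * (B * Uᴴ * majorana μ * (U * B * Uᴴ) * majorana ν) by noncomm_ring, Matrix.trace_mul_comm]
    congr 1
    noncomm_ring
  rw [sandwichMatrix, Matrix.of_apply, this, h.2.2, h.2.2]
  simp only [Finset.sum_mul, Finset.mul_sum, Matrix.smul_mul, Matrix.mul_smul, Matrix.trace_sum,
    Matrix.trace_smul, smul_eq_mul, Matrix.mul_apply, Matrix.transpose_apply, Matrix.map_apply,
    sandwichMatrix, Matrix.of_apply]
  refine Finset.sum_congr rfl fun κ _ => Finset.sum_congr rfl fun ι _ => ?_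
  ring

end Covariance

/-! ### Inverses and products of free-fermionic unitaries -/

section Composition

variable {n : ℕ} {Q Q' : Matrix (MajIdx n) (MajIdx n) ℝ} {U V : Op n}

theorem IsFreeFermionicUnitary.conjTranspose (h : IsFreeFermionicUnitary Q U) :
    IsFreeFermionicUnitary Qᵀ Uᴴ := by
  have hQ := (Matrix.mem_orthogonalGroup_iff' _ _).1 h.1
  refine ⟨(Matrix.mem_orthogonalGroup_iff _ _).2 (by simpa using hQ),
    Matrix.mem_unitaryGroup_iff.2 (by simpa [Matrix.star_eq_conjTranspose] using
      h.conjTranspose_mul), fun μ => ?_⟩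
  have hsum : ∑ ν, (Q ν μ : ℂ) • (Uᴴ * majorana ν * U) = majorana μ := by
    simp_rw [h.2.2, Finset.smul_sum, smul_smul]
    rw [Finset.sum_comm]
    simp_rw [← Finset.sum_smul]
    have : ∀ κ, ∑ ν, (Q ν μ : ℂ) * Q ν κ = if μ = κ then 1 else 0 := by
      intro κ
      have := congrFun (congrFun hQ μ) κ
      simp only [Matrix.mul_apply, Matrix.transpose_apply, Matrix.one_apply] at this
      rw [← Complex.ofReal_one, ← Complex.ofReal_zero, ← apply_ite Complex.ofReal, ← this]
      push_cast
      rfl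
    simp [this]
  rw [Matrix.conjTranspose_conjTranspose]
  conv_lhs => rw [← hsum]
  rw [Finset.mul_sum, Finset.sum_mul]
  refine Finset.sum_congr rfl fun ν _ => ?_
  rw [Matrix.mul_smul, Matrix.smul_mul, Matrix.transpose_apply,
    show U * (Uᴴ * majorana ν * U) * Uᴴ = (U * Uᴴ) * majorana ν * (U * Uᴴ) by noncomm_ring,
    h.mul_conjTranspose, one_mul, mul_one]

theorem IsFreeFermionicUnitary.mul (h : IsFreeFermionicUnitary Q U)
    (h' : IsFreeFermionicUnitary Q' V) : IsFreeFermionicUnitary (Q * Q') (U * V) := by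
  refine ⟨mul_mem h.1 h'.1, mul_mem h.2.1 h'.2.1, fun μ => ?_⟩
  rw [Matrix.conjTranspose_mul, show Vᴴ * Uᴴ * majorana μ * (U * V) =
    Vᴴ * (Uᴴ * majorana μ * U) * V by noncomm_ring, h.2.2, Finset.mul_sum, Finset.sum_mul]
  simp_rw [Matrix.mul_smul, Matrix.smul_mul, h'.2.2, Finset.smul_sum, smul_smul]
  rw [Finset.sum_comm]
  refine Finset.sum_congr rfl fun ν _ => ?_
  rw [← Finset.sum_smul, Matrix.mul_apply]
  push_cast
  rfl

end Composition

/-! ### Gaussian roots preserve parity -/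

section Parity

variable {n : ℕ} {Q : Matrix (MajIdx n) (MajIdx n) ℝ} {U : Op n}

/-- UγU† is again a linear combination of Majorana operators, and parity anticommutes with each.
This avoids deciding the sign det Q in U†PU = ±P. -/
theorem IsFreeFermionicUnitary.parity_anticomm (h : IsFreeFermionicUnitary Q U) (μ : MajIdx n) :
    (Uᴴ * parityOp n * U) * majorana μ = -(majorana μ * (Uᴴ * parityOp n * U)) := by
  have hc := h.conjTranspose.2.2 μ
  rw [Matrix.conjTranspose_conjTranspose] at hc
  have hp : parityOp n * (U * majorana μ * Uᴴ) = -((U * majorana μ * Uᴴ) * parityOp n) := by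
    rw [hc, Finset.mul_sum, Finset.sum_mul, ← Finset.sum_neg_distrib]
    refine Finset.sum_congr rfl fun ν _ => ?_
    rw [Matrix.mul_smul, Matrix.smul_mul, parityOp_mul_majorana, smul_neg]
  have h1 : (Uᴴ * parityOp n * U) * majorana μ =
      Uᴴ * (parityOp n * (U * majorana μ * Uᴴ)) * U := by
    rw [show Uᴴ * (parityOp n * (U * majorana μ * Uᴴ)) * U =
      Uᴴ * parityOp n * U * majorana μ * (Uᴴ * U) by noncomm_ring, h.conjTranspose_mul, mul_one]
  rw [h1, hp, show Uᴴ * -(U * majorana μ * Uᴴ * parityOp n) * U =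
    -((Uᴴ * U) * majorana μ * (Uᴴ * parityOp n * U)) by noncomm_ring, h.conjTranspose_mul, one_mul]

/-- Operators commuting with every `Z_i` are diagonal. -/
theorem eq_diagonal_of_commute_zOp {Y : Op n} (hY : ∀ i, Y * zOp i = zOp i * Y) :
    Y = Matrix.diagonal fun x => Y x x := by
  ext x y
  by_cases hxy : x = y
  · subst hxy
    simp
  rw [Matrix.diagonal_apply_ne _ hxy]
  obtain ⟨i, hi⟩ := Function.ne_iff.1 hxy
  have := congrFun (congrFun (hY i) x) y
  rw [zOp_eq_diagonal, Matrix.mul_diagonal, Matrix.diagonal_mul] at this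
  have hne : (zSign (y i) : ℂ) - zSign (x i) ≠ 0 := by
    rw [← Complex.ofReal_sub, Complex.ofReal_ne_zero]
    generalize x i = a at *
    generalize y i = b at *
    fin_cases a <;> fin_cases b <;> (simp [zSign] at hi ⊢; try norm_num)
  refine (mul_eq_zero.1 ?_).resolve_right hne
  linear_combination this

/-- U†PU anticommutes with every Majorana operator, hence commutes with each Z_i, a multiple of a
product of two of them. It is therefore diagonal, and commutes with the diagonal `rootState l`. -/
theorem IsFreeFermionicUnitary.parity_commute (h : IsFreeFermionicUnitary Q U) (l : Fin n → ℝ) :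
    parityOp n * (U * rootState l * Uᴴ) = U * rootState l * Uᴴ * parityOp n := by
  set Y := Uᴴ * parityOp n * U with hY
  have hz : ∀ i, Y * zOp i = zOp i * Y := by
    intro i
    have h0 := h.parity_anticomm (i, 0)
    have h1 := h.parity_anticomm (i, 1)
    rw [← hY] at h0 h1
    have : zOp i = (-Complex.I) • (majorana (i, 0) * majorana (i, 1)) := by
      rw [majorana_zero_mul_one, smul_smul, neg_mul, Complex.I_mul_I, neg_neg, one_smul]
    rw [this, Matrix.mul_smul, Matrix.smul_mul, ← mul_assoc, h0, neg_mul, mul_assoc, h1]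
    congr 1
    noncomm_ring
  have hc : Y * rootState l = rootState l * Y := by
    rw [eq_diagonal_of_commute_zOp hz, rootState_eq_diagonal, Matrix.diagonal_mul_diagonal,
      Matrix.diagonal_mul_diagonal]
    simp_rw [mul_comm]
  have e1 : parityOp n * (U * rootState l * Uᴴ) = U * (Y * rootState l) * Uᴴ := by
    rw [hY, show U * (Uᴴ * parityOp n * U * rootState l) * Uᴴ =
      (U * Uᴴ) * parityOp n * (U * rootState l * Uᴴ) by noncomm_ring, h.mul_conjTranspose, one_mul]
  rw [e1, hc, hY, show U * (rootState l * (Uᴴ * parityOp n * U)) * Uᴴ =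
    U * rootState l * Uᴴ * parityOp n * (U * Uᴴ) by noncomm_ring, h.mul_conjTranspose, mul_one]

/-- Basis vectors of the same parity differ in at least two places. -/
theorem two_le_card_ne {x y : QubitIdx n} (hxy : x ≠ y)
    (hp : ∏ j, zSign (x j) = ∏ j, zSign (y j)) :
    (2 : ℝ) ≤ ∑ i, if x i ≠ y i then 1 else 0 := by
  obtain ⟨i, hi⟩ := Function.ne_iff.1 hxy
  have : ∃ j, j ≠ i ∧ x j ≠ y j := by
    by_contra! hall
    -- A single differing bit would make this product -1, whereas equal parities make it a square.
    have h1 : ∏ j, (zSign (x j) * zSign (y j)) = -1 := by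
      rw [Finset.prod_eq_single i]
      · generalize x i = a at *
        generalize y i = b at *
        fin_cases a <;> fin_cases b <;> simp [zSign] at hi ⊢
      · intro j _ hj
        rw [hall j hj, zSign_mul_self]
      · simp
    rw [Finset.prod_mul_distrib, hp] at h1
    nlinarith [mul_self_nonneg (∏ j, zSign (y j))]
  obtain ⟨j, hji, hj⟩ := this
  rw [← Finset.sum_filter, Finset.sum_const, nsmul_eq_mul, mul_one]
  have : 1 < (Finset.univ.filter fun k => x k ≠ y k).card :=
    Finset.one_lt_card.2 ⟨j, by simpa using hj, i, by simpa using hi, hji⟩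
  exact_mod_cast Nat.succ_le_of_lt this

end Parity

/-! ### Majorana operators as signed bit flips -/

section Flips

variable {n : ℕ}

/-- The flip of the bit `i`. -/
def flip (i : Fin n) (x : QubitIdx n) : QubitIdx n := Function.update x i (x i + 1)

theorem fin_two_add_one_add_one (a : Fin 2) : a + 1 + 1 = a := by
  fin_cases a <;> rfl

theorem flip_flip (i : Fin n) (x : QubitIdx n) : flip i (flip i x) = x := by
  simp [flip, fin_two_add_one_add_one]

@[simp]
theorem flip_apply_self (i : Fin n) (x : QubitIdx n) : flip i x i = x i + 1 := by
  simp [flip]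

theorem flip_apply_ne {i j : Fin n} (h : j ≠ i) (x : QubitIdx n) : flip i x j = x j := by
  simp [flip, h]

theorem sum_flip {M : Type*} [AddCommMonoid M] (i : Fin n) (f : QubitIdx n → M) :
    ∑ x, f (flip i x) = ∑ x, f x :=
  Equiv.sum_comp (Function.Involutive.toPerm (flip i) (flip_flip i)) f

theorem majorana_apply_eq_zero (μ : MajIdx n) {x y : QubitIdx n} (h : y ≠ flip μ.1 x) :
    majorana μ x y = 0 := by
  obtain ⟨k, hk⟩ := Function.ne_iff.1 h
  rw [majorana, tensorOp, Matrix.of_apply]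
  refine Finset.prod_eq_zero (Finset.mem_univ k) ?_
  by_cases hkμ : k = μ.1
  · subst hkμ
    rw [flip_apply_self] at hk
    have : y μ.1 = x μ.1 := by
      generalize x μ.1 = a at *
      generalize y μ.1 = b at *
      fin_cases a <;> fin_cases b <;> simp at hk ⊢
    simp only [lt_irrefl, if_false, if_true, this]
    exact pauli_diag_eq_zero μ.2 _
  · rw [flip_apply_ne hkμ] at hk
    rw [if_neg hkμ]
    split_ifs
    · rw [pauliZ_eq, Matrix.diagonal_apply_ne _ (Ne.symm hk)]
    · rw [Matrix.one_apply_ne (Ne.symm hk)]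

theorem majorana_mul_mul_majorana_apply (μ : MajIdx n) (B : Op n) (x y : QubitIdx n) :
    (majorana μ * B * majorana μ) x y =
      majorana μ x (flip μ.1 x) * majorana μ (flip μ.1 y) y * B (flip μ.1 x) (flip μ.1 y) := by
  rw [Matrix.mul_apply, Finset.sum_eq_single (flip μ.1 y), Matrix.mul_apply,
    Finset.sum_eq_single (flip μ.1 x)]
  · ring
  · intro z _ hz
    rw [majorana_apply_eq_zero μ hz, zero_mul]
  · simp
  · intro z _ hz
    rw [majorana_apply_eq_zero μ, mul_zero]
    rintro rfl
    exact hz (flip_flip _ _).symm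
  · simp

/-- The product of the Jordan-Wigner signs of `x` and `y` below `i`. -/
def stringSign (i : Fin n) (x y : QubitIdx n) : ℝ :=
  ∏ k, if k < i then zSign (x k) * zSign (y k) else 1

theorem stringSign_self (i : Fin n) (x : QubitIdx n) : stringSign i x x = 1 := by
  simp [stringSign, zSign_mul_self]

theorem stringSign_mul_self (i : Fin n) (x y : QubitIdx n) :
    stringSign i x y * stringSign i x y = 1 := by
  rw [stringSign, ← Finset.prod_mul_distrib]
  refine Finset.prod_eq_one fun k _ => ?_
  split_ifs
  · linear_combination zSign (y k) * zSign (y k) * zSign_mul_self (x k) + zSign_mul_self (y k)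
  · simp

theorem pauliX_coeff (a b : Fin 2) : pauliX a (a + 1) * pauliX (b + 1) b = 1 := by
  fin_cases a <;> fin_cases b <;> simp [pauliX]

theorem pauliY_coeff (a b : Fin 2) :
    pauliY a (a + 1) * pauliY (b + 1) b = (zSign a * zSign b : ℝ) := by
  fin_cases a <;> fin_cases b <;> simp [pauliY, zSign]

/-- The qubits below the mode give the string sign; at the mode itself X contributes 1, while the
phases ±i of Y multiply to a sign. -/
theorem majorana_coeff (μ : MajIdx n) (x y : QubitIdx n) :
    majorana μ x (flip μ.1 x) * majorana μ (flip μ.1 y) y =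
      ((if μ.2 = 0 then 1 else zSign (x μ.1) * zSign (y μ.1)) * stringSign μ.1 x y : ℝ) := by
  have hprod : (if μ.2 = 0 then 1 else zSign (x μ.1) * zSign (y μ.1)) = ∏ k,
      if k = μ.1 then (if μ.2 = 0 then 1 else zSign (x μ.1) * zSign (y μ.1)) else 1 := by
    simp
  rw [hprod, stringSign, ← Finset.prod_mul_distrib, Complex.ofReal_prod, majorana, tensorOp,
    Matrix.of_apply, Matrix.of_apply, ← Finset.prod_mul_distrib]
  refine Finset.prod_congr rfl fun k _ => ?_
  rcases lt_trichotomy k μ.1 with h | h | h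
  · simp [h, h.ne, flip_apply_ne h.ne, pauliZ_eq]
  · subst h
    simp only [lt_irrefl, if_false, if_true, flip_apply_self, mul_one]
    split_ifs
    · rw [pauliX_coeff, Complex.ofReal_one]
    · exact pauliY_coeff _ _
  · rw [flip_apply_ne h.ne', flip_apply_ne h.ne']
    simp [h.not_gt, h.ne']

end Flips

/-! ### Overlap bounded by the mean number of excitations -/

section SpectralGap

/-- Pythagoras in the orthonormal basis (a, b), (b, -a). -/
theorem norm_sq_add_norm_sq_sub {a b : ℝ} (h : a ^ 2 + b ^ 2 = 1) (u v : ℂ) :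
    ‖u‖ ^ 2 + ‖v‖ ^ 2 - ‖(a : ℂ) * u + b * v‖ ^ 2 = ‖(b : ℂ) * u - a * v‖ ^ 2 := by
  simp only [Complex.sq_norm, Complex.normSq_apply, Complex.add_re, Complex.sub_re,
    Complex.add_im, Complex.sub_im, Complex.re_ofReal_mul, Complex.im_ofReal_mul]
  linear_combination (-(u.re ^ 2 + u.im ^ 2 + v.re ^ 2 + v.im ^ 2)) * h

theorem sum_qubitIdx_succ {M : Type*} [AddCommMonoid M] {n : ℕ} (f : QubitIdx (n + 1) → M) :
    ∑ x, f x = ∑ x : QubitIdx n, (f (Fin.cons 0 x) + f (Fin.cons 1 x)) := by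
  rw [← Equiv.sum_comp (Fin.consEquiv fun _ => Fin 2), Fintype.sum_prod_type_right]
  simp [Fin.consEquiv]

theorem flip_zero_cons {n : ℕ} (a : Fin 2) (x : QubitIdx n) :
    flip 0 (Fin.cons a x : QubitIdx (n + 1)) = (Fin.cons (a + 1) x : QubitIdx (n + 1)) := by
  simp [flip, Fin.update_cons_zero]

theorem flip_succ_cons {n : ℕ} (i : Fin n) (a : Fin 2) (x : QubitIdx n) :
    flip i.succ (Fin.cons a x : QubitIdx (n + 1)) = (Fin.cons a (flip i x) : QubitIdx (n + 1)) := by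
  simp [flip, Fin.cons_update]

/-- An Efron-Stein inequality: the weight of `f` outside a product vector is bounded by its local
excitations. -/
theorem sub_norm_sq_le_sum_local {n : ℕ} {l : Fin n → ℝ} (hl : ∀ j, l j ∈ Set.Icc (-1 : ℝ) 1)
    (f : QubitIdx n → ℂ) :
    ∑ x, ‖f x‖ ^ 2 - ‖∑ x, ((∏ j, amp (l j) (x j) : ℝ) : ℂ) * f x‖ ^ 2 ≤
      1 / 2 * ∑ i, ∑ x, ‖(amp (l i) (x i + 1) : ℂ) * f x -
        amp (l i) (x i) * f (flip i x)‖ ^ 2 := by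
  induction n with
  | zero => simp
  | succ n ih =>
    have h0 := amp_sq_add (hl 0)
    set a := amp (l 0) 0 with ha
    set b := amp (l 0) 1 with hb
    -- The first qubit is contracted against its amplitude vector.
    let g : QubitIdx n → ℂ := fun x => (a : ℂ) * f (Fin.cons 0 x) + b * f (Fin.cons 1 x)
    have hg := ih (fun j => hl j.succ) g
    have e1 : ∑ x, ((∏ j, amp (l j) (x j) : ℝ) : ℂ) * f x =
        ∑ x : QubitIdx n, ((∏ j, amp (l j.succ) (x j) : ℝ) : ℂ) * g x := by
      rw [sum_qubitIdx_succ]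
      refine Finset.sum_congr rfl fun x _ => ?_
      simp only [Fin.prod_univ_succ, Fin.cons_zero, Fin.cons_succ, ← ha, ← hb, g]
      push_cast
      ring
    -- The values 0 and 1 of the first bit give the same residual up to sign; this double counting
    -- is the origin of the factor 1/2.
    have e2 : ∑ x, ‖f x‖ ^ 2 = ∑ x, ‖g x‖ ^ 2 + 1 / 2 * ∑ x, ‖(amp (l 0) (x 0 + 1) : ℂ) * f x -
        amp (l 0) (x 0) * f (flip 0 x)‖ ^ 2 := by
      rw [sum_qubitIdx_succ, sum_qubitIdx_succ, Finset.mul_sum, ← Finset.sum_add_distrib]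
      refine Finset.sum_congr rfl fun x _ => ?_
      have := norm_sq_add_norm_sq_sub h0 (f (Fin.cons 0 x)) (f (Fin.cons 1 x))
      simp only [Fin.cons_zero, flip_zero_cons, zero_add, show (1 : Fin 2) + 1 = 0 from rfl, ← ha,
        ← hb, g]
      rw [norm_sub_rev ((a : ℂ) * f (Fin.cons 1 x))]
      linarith
    -- Contracting the first qubit with a unit vector commutes with the local term at a later qubit
    -- and cannot increase its norm.
    have e3 : ∀ i : Fin n, ∑ x, ‖(amp (l i.succ) (x i + 1) : ℂ) * g x -
        amp (l i.succ) (x i) * g (flip i x)‖ ^ 2 ≤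
        ∑ x, ‖(amp (l i.succ) (x i.succ + 1) : ℂ) * f x -
          amp (l i.succ) (x i.succ) * f (flip i.succ x)‖ ^ 2 := by
      intro i
      rw [sum_qubitIdx_succ]
      refine Finset.sum_le_sum fun x _ => ?_
      simp only [Fin.cons_succ, flip_succ_cons, g]
      set u := (amp (l i.succ) (x i + 1) : ℂ) * f (Fin.cons 0 x) -
        amp (l i.succ) (x i) * f (Fin.cons 0 (flip i x)) with hu
      set v := (amp (l i.succ) (x i + 1) : ℂ) * f (Fin.cons 1 x) -
        amp (l i.succ) (x i) * f (Fin.cons 1 (flip i x)) with hv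
      have := norm_sq_add_norm_sq_sub h0 u v
      have hpos := sq_nonneg ‖(b : ℂ) * u - a * v‖
      refine le_trans (le_of_eq ?_) (show ‖(a : ℂ) * u + b * v‖ ^ 2 ≤ _ by linarith)
      congr 2
      rw [hu, hv]
      ring
    have e4 := Finset.sum_le_sum fun i (_ : i ∈ Finset.univ) => e3 i
    rw [e1, e2, Fin.sum_univ_succ]
    linarith

variable {n : ℕ} {l : Fin n → ℝ}

/-- The excitation density of the mode `i` of an operator relative to a product state. -/
def excitation (l : Fin n → ℝ) (B : Op n) (i : Fin n) (x y : QubitIdx n) : ℝ :=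
  if x i ≠ y i then ‖B x y‖ ^ 2
  else ‖(amp (l i) (x i + 1) : ℂ) * B x y -
    stringSign i x y * (amp (l i) (x i) * B (flip i x) (flip i y))‖ ^ 2

/-- Diagonal entries of B are handled by `sub_norm_sq_le_sum_local`. An off-diagonal entry joins
strings of equal parity, which differ in at least two bits, and each such bit contributes ‖B x y‖²;
this pays for the factor 1/2. -/
theorem one_sub_overlap_le_excitation (hl : ∀ j, l j ∈ Set.Icc (-1 : ℝ) 1) (B : Op n)
    (hB : ∑ x, ∑ y, ‖B x y‖ ^ 2 = 1)
    (hp : ∀ x y, B x y ≠ 0 → ∏ j, zSign (x j) = ∏ j, zSign (y j)) :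
    1 - ‖(rootState l * B).trace‖ ^ 2 ≤ 1 / 2 * ∑ i, ∑ x, ∑ y, excitation l B i x y := by
  have htr : (rootState l * B).trace = ∑ x, ((∏ j, amp (l j) (x j) : ℝ) : ℂ) * B x x := by
    rw [rootState_eq_diagonal]
    simp only [Matrix.trace, Matrix.diag_apply, Matrix.diagonal_mul]
  have hdiag := sub_norm_sq_le_sum_local hl fun x => B x x
  -- On the diagonal this is an equality, as the string sign is 1 there; the subtracted ‖B x x‖² is
  -- recovered from `hdiag` after summation.
  have hx : ∀ x y, ‖B x y‖ ^ 2 + (if x = y then 1 / 2 * ∑ i, ‖(amp (l i) (x i + 1) : ℂ) * B x x -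
      amp (l i) (x i) * B (flip i x) (flip i x)‖ ^ 2 - ‖B x x‖ ^ 2 else 0) ≤
      1 / 2 * ∑ i, excitation l B i x y := by
    intro x y
    by_cases hxy : x = y
    · subst hxy
      simp [excitation, stringSign_self]
    · rw [if_neg hxy, add_zero]
      by_cases h0 : B x y = 0
      · rw [h0, norm_zero, zero_pow two_ne_zero]
        refine mul_nonneg (by norm_num) (Finset.sum_nonneg fun i _ => ?_)
        rw [excitation]
        split_ifs <;> positivity
      · have h2 := mul_le_mul_of_nonneg_right (two_le_card_ne hxy (hp x y h0))
          (sq_nonneg ‖B x y‖)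
        rw [Finset.sum_mul] at h2
        have h3 : ∑ i, (if x i ≠ y i then 1 else 0) * ‖B x y‖ ^ 2 ≤
            ∑ i, excitation l B i x y := by
          refine Finset.sum_le_sum fun i _ => ?_
          rw [excitation]
          split_ifs
          · rw [one_mul]
          · rw [zero_mul]
            positivity
        linarith
  have hsum := Finset.sum_le_sum fun x (_ : x ∈ Finset.univ) =>
    Finset.sum_le_sum fun y (_ : y ∈ Finset.univ) => hx x y
  simp only [Finset.sum_add_distrib, Finset.sum_ite_eq, Finset.mem_univ, if_true,
    Finset.sum_sub_distrib, ← Finset.mul_sum, hB] at hsum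
  have hcomm : ∑ x, ∑ y, ∑ i, excitation l B i x y = ∑ i, ∑ x, ∑ y, excitation l B i x y := by
    rw [Finset.sum_comm]
    simp_rw [Finset.sum_comm (s := Finset.univ (α := QubitIdx n)) (t := Finset.univ (α := Fin n))]
    exact Finset.sum_congr rfl fun i _ => Finset.sum_comm
  have hcomm' : ∑ i, ∑ x, ‖(amp (l i) (x i + 1) : ℂ) * B x x -
      amp (l i) (x i) * B (flip i x) (flip i x)‖ ^ 2 = ∑ x, ∑ i, ‖(amp (l i) (x i + 1) : ℂ) * B x x -
      amp (l i) (x i) * B (flip i x) (flip i x)‖ ^ 2 := Finset.sum_comm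
  rw [htr]
  rw [hcomm] at hsum
  rw [hcomm'] at hdiag
  linarith

theorem trace_mul_of_isHermitian {B : Op n} (hB : B.IsHermitian) (C : Op n) :
    (B * C).trace = ∑ x, ∑ y, star (B x y) * C x y := by
  simp only [Matrix.trace, Matrix.diag_apply, Matrix.mul_apply]
  rw [Finset.sum_comm]
  refine Finset.sum_congr rfl fun x _ => Finset.sum_congr rfl fun y _ => ?_
  rw [hB.apply]

theorem mul_self_diag_of_isHermitian {B : Op n} (hB : B.IsHermitian) (x : QubitIdx n) :
    (B * B) x x = ((∑ y, ‖B x y‖ ^ 2 : ℝ) : ℂ) := by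
  rw [Matrix.mul_apply]
  push_cast
  refine Finset.sum_congr rfl fun y _ => ?_
  rw [← hB.apply y x, Complex.star_def, Complex.mul_conj']

/-- Symmetrised through ‖B x y‖ = ‖B y x‖, so that entries with x i ≠ y i drop out, as they do in
`re_sandwichMatrix_add`. -/
theorem re_trace_zOp_mul_sq {B : Op n} (hB : B.IsHermitian) (i : Fin n) :
    (zOp i * (B * B)).trace.re =
      ∑ x, ∑ y, (zSign (x i) + zSign (y i)) / 2 * ‖B x y‖ ^ 2 := by
  have h1 : (zOp i * (B * B)).trace.re = ∑ x, ∑ y, zSign (x i) * ‖B x y‖ ^ 2 := by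
    simp only [zOp_eq_diagonal, Matrix.trace, Matrix.diag_apply, Matrix.diagonal_mul,
      mul_self_diag_of_isHermitian hB, Complex.re_sum, ← Complex.ofReal_mul, Complex.ofReal_re,
      Finset.mul_sum]
  have h2 : ∑ x, ∑ y, zSign (y i) * ‖B x y‖ ^ 2 = ∑ x, ∑ y, zSign (x i) * ‖B x y‖ ^ 2 := by
    rw [Finset.sum_comm]
    refine Finset.sum_congr rfl fun x _ => Finset.sum_congr rfl fun y _ => ?_
    rw [← hB.apply y x, norm_star]
  have h3 : ∑ x, ∑ y, (zSign (x i) + zSign (y i)) / 2 * ‖B x y‖ ^ 2 =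
      (∑ x, ∑ y, zSign (x i) * ‖B x y‖ ^ 2 + ∑ x, ∑ y, zSign (y i) * ‖B x y‖ ^ 2) / 2 := by
    simp_rw [← Finset.sum_add_distrib, Finset.sum_div]
    refine Finset.sum_congr rfl fun x _ => Finset.sum_congr rfl fun y _ => ?_
    ring
  rw [h3, h2, h1]
  ring

/-- The X term has weight 1 and the Y term the product of the two signs: they add when the bits
agree and cancel otherwise. -/
theorem re_sandwichMatrix_add {B : Op n} (hB : B.IsHermitian) (i : Fin n) :
    (sandwichMatrix B (i, 0) (i, 0) + sandwichMatrix B (i, 1) (i, 1)).re =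
      ∑ x, ∑ y, (1 + zSign (x i) * zSign (y i)) * stringSign i x y *
        (star (B x y) * B (flip i x) (flip i y)).re := by
  have h : ∀ μ : MajIdx n, sandwichMatrix B μ μ = ∑ x, ∑ y, star (B x y) *
      (((if μ.2 = 0 then 1 else zSign (x μ.1) * zSign (y μ.1)) * stringSign μ.1 x y : ℝ) *
        B (flip μ.1 x) (flip μ.1 y)) := by
    intro μ
    rw [sandwichMatrix, Matrix.of_apply, mul_assoc, mul_assoc, ← mul_assoc (majorana μ),
      trace_mul_of_isHermitian hB]
    refine Finset.sum_congr rfl fun x _ => Finset.sum_congr rfl fun y _ => ?_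
    rw [majorana_mul_mul_majorana_apply, majorana_coeff]
  rw [h, h]
  simp only [← Finset.sum_add_distrib, Complex.re_sum]
  refine Finset.sum_congr rfl fun x _ => Finset.sum_congr rfl fun y _ => ?_
  rw [← Complex.re_ofReal_mul]
  congr 1
  simp
  ring

theorem norm_sub_sq_real_coeff (w v t : ℝ) (ht : t * t = 1) (a b : ℂ) :
    ‖(w : ℂ) * a - t * (v * b)‖ ^ 2 =
      w ^ 2 * ‖a‖ ^ 2 + v ^ 2 * ‖b‖ ^ 2 - 2 * (w * v * t * (star a * b).re) := by
  simp only [Complex.sq_norm, Complex.normSq_apply, Complex.sub_re, Complex.sub_im,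
    Complex.re_ofReal_mul, Complex.im_ofReal_mul]
  simp only [Complex.star_def, Complex.mul_re, Complex.conj_re, Complex.conj_im]
  linear_combination (v ^ 2 * (b.re ^ 2 + b.im ^ 2)) * ht

theorem zSign_add_one (a : Fin 2) : zSign (a + 1) = -zSign a := by
  fin_cases a <;> simp [zSign]

theorem amp_add_one_mul_amp (t : ℝ) (a : Fin 2) : amp t (a + 1) * amp t a = spread t / 2 := by
  rw [spread]
  fin_cases a
  · simp
    ring
  · simp [show (1 : Fin 2) + 1 = 0 from rfl]

/-- The total excitation of a mode, expressed by traces. -/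
theorem sum_excitation (hl : ∀ j, l j ∈ Set.Icc (-1 : ℝ) 1) {B : Op n} (hB : B.IsHermitian)
    (hn : ∑ x, ∑ y, ‖B x y‖ ^ 2 = 1) (i : Fin n) :
    ∑ x, ∑ y, excitation l B i x y = 1 - l i * (zOp i * (B * B)).trace.re -
      spread (l i) / 2 * (sandwichMatrix B (i, 0) (i, 0) + sandwichMatrix B (i, 1) (i, 1)).re := by
  -- Expanding the square gives K at (x, y) and at the flipped pair. Since both have the same total,
  -- the second is traded for another copy of the first, and 2 · amp² = 1 - l · zSign (x i).
  let K : QubitIdx n → QubitIdx n → ℝ := fun x y =>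
    if x i = y i then amp (l i) (x i + 1) ^ 2 * ‖B x y‖ ^ 2 else 0
  have hK : ∑ x, ∑ y, K (flip i x) (flip i y) = ∑ x, ∑ y, K x y := by
    rw [sum_flip i fun x => ∑ y, K x (flip i y)]
    exact Finset.sum_congr rfl fun x _ => sum_flip i (K x)
  have hpt : ∀ x y, excitation l B i x y + K x y = ‖B x y‖ ^ 2 -
      l i * ((zSign (x i) + zSign (y i)) / 2 * ‖B x y‖ ^ 2) - spread (l i) / 2 *
        ((1 + zSign (x i) * zSign (y i)) * stringSign i x y *
        (star (B x y) * B (flip i x) (flip i y)).re) + K (flip i x) (flip i y) := by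
    intro x y
    simp only [excitation, K, flip_apply_self, fin_two_add_one_add_one, add_left_inj]
    by_cases hxy : x i = y i
    · rw [if_neg (not_not.2 hxy), if_pos hxy, if_pos hxy,
        norm_sub_sq_real_coeff _ _ _ (stringSign_mul_self i x y), amp_add_one_mul_amp, ← hxy,
        zSign_mul_self, amp_sq (hl i) (x i + 1), zSign_add_one]
      ring
    · have hs : zSign (y i) = -zSign (x i) := by
        generalize x i = a at *
        generalize y i = b at *
        fin_cases a <;> fin_cases b <;> simp [zSign] at hxy ⊢
      rw [if_pos hxy, if_neg hxy, if_neg hxy, hs, mul_neg, zSign_mul_self]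
      ring
  have hsum := Finset.sum_congr rfl fun x (_ : x ∈ Finset.univ) =>
    Finset.sum_congr rfl fun y (_ : y ∈ Finset.univ) => hpt x y
  simp only [Finset.sum_add_distrib, Finset.sum_sub_distrib, ← Finset.mul_sum, hn] at hsum
  rw [re_trace_zOp_mul_sq hB, re_sandwichMatrix_add hB]
  linarith

/-- The overlap of two Gaussian roots in terms of their correlation matrices. -/
theorem one_sub_overlap_le (hl : ∀ j, l j ∈ Set.Icc (-1 : ℝ) 1) {B : Op n} (hB : B.IsHermitian)
    (hn : (B * B).trace = 1) (hp : parityOp n * B = B * parityOp n) :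
    1 - ‖(rootState l * B).trace‖ ^ 2 ≤ 1 / 2 * ((n : ℝ) +
      1 / 2 * (productCorrelation l * correlationMatrix (B * B)).trace.re -
      1 / 2 * (Matrix.diagonal (fun μ : MajIdx n => (spread (l μ.1) : ℂ)) *
        sandwichMatrix B).trace.re) := by
  have hn' : ∑ x, ∑ y, ‖B x y‖ ^ 2 = 1 := by
    simp only [Matrix.trace, Matrix.diag_apply, mul_self_diag_of_isHermitian hB] at hn
    exact_mod_cast hn
  refine (one_sub_overlap_le_excitation hl B hn' fun x y h => ?_).trans (le_of_eq ?_)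
  · have := congrFun (congrFun hp x) y
    rw [parityOp_eq_diagonal, Matrix.diagonal_mul, Matrix.mul_diagonal, mul_comm] at this
    exact_mod_cast mul_left_cancel₀ h this
  · have h1 : (productCorrelation l * correlationMatrix (B * B)).trace.re =
        -2 * ∑ i, l i * (zOp i * (B * B)).trace.re := by
      have : ∀ i, ∀ s : Fin 2, (productCorrelation l * correlationMatrix (B * B)) (i, s) (i, s) =
          -((l i : ℂ) * (zOp i * (B * B)).trace) := by
        intro i s
        rw [Matrix.mul_apply, Fintype.sum_prod_type, Finset.sum_eq_single i]
        · fin_cases s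
          · simp [productCorrelation, correlationMatrix_one_zero]
          · simp [productCorrelation, correlationMatrix_zero_one]
        · intro j _ hj
          simp [productCorrelation, hj.symm]
        · simp
      rw [Matrix.trace, Fintype.sum_prod_type, Complex.re_sum, Finset.mul_sum]
      refine Finset.sum_congr rfl fun i _ => ?_
      simp only [Matrix.diag_apply, this, Fin.sum_univ_two, Complex.add_re, Complex.neg_re,
        Complex.re_ofReal_mul]
      ring
    have h2 : (Matrix.diagonal (fun μ : MajIdx n => (spread (l μ.1) : ℂ)) *
        sandwichMatrix B).trace.re = ∑ i, spread (l i) *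
          (sandwichMatrix B (i, 0) (i, 0) + sandwichMatrix B (i, 1) (i, 1)).re := by
      rw [Matrix.trace, Fintype.sum_prod_type, Complex.re_sum]
      refine Finset.sum_congr rfl fun i _ => ?_
      simp only [Matrix.diag_apply, Matrix.diagonal_mul, Fin.sum_univ_two, ← mul_add,
        Complex.re_ofReal_mul]
    simp_rw [sum_excitation hl hB hn', Finset.sum_sub_distrib]
    rw [h1, h2]
    simp_rw [div_mul_eq_mul_div, ← Finset.sum_div]
    simp
    ring

end SpectralGap

/-! ### The relation S² = 1 + Γ² for Gaussian roots -/

section CorrelationMatrices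

variable {n : ℕ}

theorem productCorrelation_conjTranspose (l : Fin n → ℝ) :
    (productCorrelation l)ᴴ = -productCorrelation l := by
  ext ⟨i, s⟩ ⟨j, t⟩
  by_cases h : i = j
  · subst h
    fin_cases s <;> fin_cases t <;> simp [productCorrelation]
  · simp [productCorrelation, h, Ne.symm h]

theorem productCorrelation_mul_self (l : Fin n → ℝ) :
    productCorrelation l * productCorrelation l =
      Matrix.diagonal fun μ => -((l μ.1 : ℂ) * l μ.1) := by
  ext ⟨i, s⟩ ⟨j, t⟩
  rw [Matrix.mul_apply, Fintype.sum_prod_type, Finset.sum_eq_single i]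
  · by_cases h : i = j
    · subst h
      fin_cases s <;> fin_cases t <;> simp [productCorrelation]
    · rw [Matrix.diagonal_apply_ne _ (by simp [h])]
      simp [productCorrelation, h]
  · intro k _ hk
    simp [productCorrelation, hk.symm]
  · simp

theorem toComplex_conjTranspose (Q : Matrix (MajIdx n) (MajIdx n) ℝ) :
    (toComplex Q)ᴴ = (toComplex Q)ᵀ := by
  ext μ ν
  simp

variable {Q : Matrix (MajIdx n) (MajIdx n) ℝ} {U : Op n} {l : Fin n → ℝ}

/-- The square root of a free-fermionic state. -/
def conjRoot (U : Op n) (l : Fin n → ℝ) : Op n := U * rootState l * Uᴴ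

theorem conjRoot_posSemidef (U : Op n) (l : Fin n → ℝ) : (conjRoot U l).PosSemidef :=
  (rootState_posSemidef l).mul_mul_conjTranspose_same U

theorem conjRoot_mul_self (h : IsFreeFermionicUnitary Q U) (hl : ∀ j, l j ∈ Set.Icc (-1 : ℝ) 1) :
    conjRoot U l * conjRoot U l = U * productState l * Uᴴ := by
  rw [conjRoot, show U * rootState l * Uᴴ * (U * rootState l * Uᴴ) =
    U * (rootState l * (Uᴴ * U) * rootState l) * Uᴴ by noncomm_ring, h.conjTranspose_mul, mul_one,
    rootState_mul_self hl]

theorem trace_conjRoot_mul_self (h : IsFreeFermionicUnitary Q U)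
    (hl : ∀ j, l j ∈ Set.Icc (-1 : ℝ) 1) : (conjRoot U l * conjRoot U l).trace = 1 := by
  rw [conjRoot_mul_self h hl, Matrix.trace_mul_comm, ← mul_assoc, h.conjTranspose_mul, one_mul,
    trace_productState]

theorem correlationMatrix_conjRoot (h : IsFreeFermionicUnitary Q U)
    (hl : ∀ j, l j ∈ Set.Icc (-1 : ℝ) 1) :
    correlationMatrix (conjRoot U l * conjRoot U l) =
      toComplex Q * productCorrelation l * (toComplex Q)ᵀ := by
  rw [conjRoot_mul_self h hl, correlationMatrix_conj h, correlationMatrix_productState hl]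

theorem sandwichMatrix_conjRoot (h : IsFreeFermionicUnitary Q U)
    (hl : ∀ j, l j ∈ Set.Icc (-1 : ℝ) 1) :
    sandwichMatrix (conjRoot U l) =
      toComplex Q * Matrix.diagonal (fun μ => (spread (l μ.1) : ℂ)) * (toComplex Q)ᵀ := by
  rw [conjRoot, sandwichMatrix_conj h, sandwichMatrix_rootState hl]

theorem sandwichMatrix_conjRoot_posSemidef (h : IsFreeFermionicUnitary Q U)
    (hl : ∀ j, l j ∈ Set.Icc (-1 : ℝ) 1) : (sandwichMatrix (conjRoot U l)).PosSemidef := by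
  rw [sandwichMatrix_conjRoot h hl, ← toComplex_conjTranspose]
  refine Matrix.PosSemidef.mul_mul_conjTranspose_same (Matrix.PosSemidef.diagonal fun μ => ?_) _
  rw [Pi.zero_apply, Complex.zero_le_real]
  exact spread_nonneg _

theorem correlationMatrix_conjRoot_conjTranspose (h : IsFreeFermionicUnitary Q U)
    (hl : ∀ j, l j ∈ Set.Icc (-1 : ℝ) 1) :
    (correlationMatrix (conjRoot U l * conjRoot U l))ᴴ =
      -correlationMatrix (conjRoot U l * conjRoot U l) := by
  rw [correlationMatrix_conjRoot h hl, ← toComplex_conjTranspose]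
  simp only [Matrix.conjTranspose_mul, Matrix.conjTranspose_conjTranspose,
    productCorrelation_conjTranspose]
  noncomm_ring

/-- The orthogonal rotation reduces this to one mode, where S is √(1 - l²) times the identity and Γ
squares to -l². -/
theorem sandwichMatrix_conjRoot_mul_self (h : IsFreeFermionicUnitary Q U)
    (hl : ∀ j, l j ∈ Set.Icc (-1 : ℝ) 1) :
    sandwichMatrix (conjRoot U l) * sandwichMatrix (conjRoot U l) =
      1 + correlationMatrix (conjRoot U l * conjRoot U l) *
        correlationMatrix (conjRoot U l * conjRoot U l) := by
  have hmul : ∀ X : Matrix (MajIdx n) (MajIdx n) ℂ,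
      toComplex Q * X * (toComplex Q)ᵀ * (toComplex Q * X * (toComplex Q)ᵀ) =
        toComplex Q * (X * X) * (toComplex Q)ᵀ := by
    intro X
    rw [show ∀ R R' : Matrix (MajIdx n) (MajIdx n) ℂ, R * X * R' * (R * X * R') =
      R * (X * (R' * R) * X) * R' by intro R R'; noncomm_ring, h.transpose_mul_toComplex, mul_one]
  rw [correlationMatrix_conjRoot h hl, sandwichMatrix_conjRoot h hl, hmul, hmul,
    productCorrelation_mul_self, Matrix.diagonal_mul_diagonal]
  have : Matrix.diagonal (fun μ : MajIdx n => (spread (l μ.1) : ℂ) * spread (l μ.1)) =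
      1 + Matrix.diagonal fun μ : MajIdx n => -((l μ.1 : ℂ) * l μ.1) := by
    rw [← Matrix.diagonal_one, Matrix.diagonal_add]
    congr 1
    funext μ
    rw [← Complex.ofReal_mul, spread_mul_self (hl _)]
    push_cast
    ring
  rw [this, mul_add, add_mul, mul_one, h.toComplex_mul_transpose]

end CorrelationMatrices

/-! ### Overlap of two Gaussian roots -/

section Overlap

variable {n : ℕ} {Q₁ Q₂ : Matrix (MajIdx n) (MajIdx n) ℝ} {U₁ U₂ : Op n} {l₁ l₂ : Fin n → ℝ}

theorem trace_conj_mul_conj {ι : Type*} [Fintype ι] (R₁ R₁' R₂ R₂' X Y : Matrix ι ι ℂ) :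
    (X * ((R₁' * R₂) * Y * (R₂' * R₁))).trace = ((R₁ * X * R₁') * (R₂ * Y * R₂')).trace := by
  rw [show (R₁ * X * R₁') * (R₂ * Y * R₂') = R₁ * (X * R₁' * (R₂ * Y * R₂')) by
    simp only [mul_assoc], Matrix.trace_mul_comm R₁]
  congr 1
  simp only [mul_assoc]

/-- The overlap of the roots of two free-fermionic states, in terms of the correlation matrices. -/
theorem one_sub_sq_re_trace_conjRoot_le (h₁ : IsFreeFermionicUnitary Q₁ U₁)
    (h₂ : IsFreeFermionicUnitary Q₂ U₂) (hl₁ : ∀ j, l₁ j ∈ Set.Icc (-1 : ℝ) 1)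
    (hl₂ : ∀ j, l₂ j ∈ Set.Icc (-1 : ℝ) 1) :
    1 - (conjRoot U₁ l₁ * conjRoot U₂ l₂).trace.re ^ 2 ≤ 1 / 2 * ((n : ℝ) +
      1 / 2 * (correlationMatrix (conjRoot U₁ l₁ * conjRoot U₁ l₁) *
        correlationMatrix (conjRoot U₂ l₂ * conjRoot U₂ l₂)).trace.re -
      1 / 2 * (sandwichMatrix (conjRoot U₁ l₁) * sandwichMatrix (conjRoot U₂ l₂)).trace.re) := by
  -- Only the relative rotation matters: the first state becomes a product state, and the traces are
  -- invariant under rotating back.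
  have h := h₁.conjTranspose.mul h₂
  have key := one_sub_overlap_le hl₁ (conjRoot_posSemidef (U₁ᴴ * U₂) l₂).1
    (trace_conjRoot_mul_self h hl₂) (h.parity_commute l₂)
  have hQ : toComplex (Q₁ᵀ * Q₂) = (toComplex Q₁)ᵀ * toComplex Q₂ := by
    ext μ ν
    simp [Matrix.mul_apply]
  have hQ' : (toComplex (Q₁ᵀ * Q₂))ᵀ = (toComplex Q₂)ᵀ * toComplex Q₁ := by
    rw [hQ, Matrix.transpose_mul, Matrix.transpose_transpose]
  have htr : (rootState l₁ * conjRoot (U₁ᴴ * U₂) l₂).trace =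
      (conjRoot U₁ l₁ * conjRoot U₂ l₂).trace := by
    rw [conjRoot, Matrix.conjTranspose_mul, Matrix.conjTranspose_conjTranspose]
    exact trace_conj_mul_conj _ _ _ _ _ _
  -- The trace of a product of two Hermitian matrices is real, so its squared norm is the square of
  -- its real part.
  have him : (conjRoot U₁ l₁ * conjRoot U₂ l₂).trace.im = 0 := by
    rw [← Complex.conj_eq_iff_im, ← Complex.star_def, ← Matrix.trace_conjTranspose,
      Matrix.conjTranspose_mul, (conjRoot_posSemidef U₁ l₁).1.eq, (conjRoot_posSemidef U₂ l₂).1.eq,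
      Matrix.trace_mul_comm]
  rw [correlationMatrix_conjRoot h hl₂, sandwichMatrix_conjRoot h hl₂, hQ', hQ,
    trace_conj_mul_conj, trace_conj_mul_conj, ← correlationMatrix_conjRoot h₁ hl₁,
    ← correlationMatrix_conjRoot h₂ hl₂, ← sandwichMatrix_conjRoot h₁ hl₁,
    ← sandwichMatrix_conjRoot h₂ hl₂, htr, Complex.sq_norm, Complex.normSq_apply, him, mul_zero,
    add_zero, ← pow_two] at key
  exact key

/-- Tr S² = 2n + Tr Γ², while Γ†Γ = -Γ². The terms Tr Γ₁² and Tr Γ₂² therefore cancel between the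
two squared norms, leaving the cross terms and 4n. -/
theorem four_mul_add_traces {S₁ S₂ Γ₁ Γ₂ : Matrix (MajIdx n) (MajIdx n) ℂ}
    (hΓ₁ : Γ₁ᴴ = -Γ₁) (hΓ₂ : Γ₂ᴴ = -Γ₂)
    (h₁ : S₁ * S₁ = 1 + Γ₁ * Γ₁) (h₂ : S₂ * S₂ = 1 + Γ₂ * Γ₂) :
    4 * ((n : ℝ) + 1 / 2 * (Γ₁ * Γ₂).trace.re - 1 / 2 * (S₁ * S₂).trace.re) =
      ((Γ₁ - Γ₂)ᴴ * (Γ₁ - Γ₂)).trace.re + ((S₁ - S₂) * (S₁ - S₂)).trace.re := by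
  have t₁ := congrArg (fun M => M.trace.re) h₁
  have t₂ := congrArg (fun M => M.trace.re) h₂
  have c₁ := Matrix.trace_mul_comm Γ₂ Γ₁
  have c₂ := Matrix.trace_mul_comm S₂ S₁
  rw [Matrix.conjTranspose_sub, hΓ₁, hΓ₂]
  simp only [sub_mul, mul_sub, Matrix.trace_sub, Matrix.trace_add, Complex.sub_re, Complex.add_re,
    neg_mul, Matrix.trace_neg, Complex.neg_re, Matrix.trace_one, c₁, c₂] at t₁ t₂ ⊢
  simp at t₁ t₂
  linarith

end Overlap

end FreeFermion

end

/-- Fidelity lower bound between two (possibly mixed) free-fermionic states. -/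
theorem mainTheorem8 (n : ℕ) (ρ σ : FreeFermion.Op n)
    (hρ : FreeFermion.IsFreeFermionicState ρ) (hσ : FreeFermion.IsFreeFermionicState σ) :
    FreeFermion.fidelity σ ρ ≥
      1 - (1 / 4 : ℝ) * FreeFermion.schattenNorm 1
            (FreeFermion.correlationMatrix ρ - FreeFermion.correlationMatrix σ)
        - (1 / 8 : ℝ) * FreeFermion.schattenNorm 2
            (FreeFermion.correlationMatrix ρ - FreeFermion.correlationMatrix σ) ^ 2 := by
  obtain ⟨Q₁, U₁, l₁, h₁, hl₁, rfl⟩ := hρ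
  obtain ⟨Q₂, U₂, l₂, h₂, hl₂, rfl⟩ := hσ
  rw [← FreeFermion.conjRoot_mul_self h₁ hl₁, ← FreeFermion.conjRoot_mul_self h₂ hl₂]
  have hF := FreeFermion.sq_re_trace_mul_le_fidelity (FreeFermion.conjRoot_posSemidef U₁ l₁)
    (FreeFermion.conjRoot_posSemidef U₂ l₂) rfl rfl
  have hO := FreeFermion.one_sub_sq_re_trace_conjRoot_le h₁ h₂ hl₁ hl₂
  have hΓ₁ := FreeFermion.correlationMatrix_conjRoot_conjTranspose h₁ hl₁
  have hΓ₂ := FreeFermion.correlationMatrix_conjRoot_conjTranspose h₂ hl₂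
  have hS₁ := FreeFermion.sandwichMatrix_conjRoot_mul_self h₁ hl₁
  have hS₂ := FreeFermion.sandwichMatrix_conjRoot_mul_self h₂ hl₂
  have hT := FreeFermion.four_mul_add_traces hΓ₁ hΓ₂ hS₁ hS₂
  have hP := FreeFermion.re_trace_sq_sub_le (FreeFermion.sandwichMatrix_conjRoot_posSemidef h₁ hl₁)
    (FreeFermion.sandwichMatrix_conjRoot_posSemidef h₂ hl₂) hΓ₁ hΓ₂ hS₁ hS₂
  rw [FreeFermion.schattenNorm_one, FreeFermion.schattenNorm_two_sq]
  linarith
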